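/- Let $M$ be a (many-sorted) metric structure in continuous first-order logic: every sort is a complete metric space of diameter at most $1$, and the function symbols and $[0,1]$-valued predicate symbols are interpreted by uniformly continuous maps. A finite product of sorts is again regarded as a sort, with the maximum metric $d$. Let $A$ be a set of parameters in $M$. A predicate is *$A$-definable* if it is a uniform limit of formulae with parameters in $A$. A subset $X$ of a sort is an *$A$-definable set* if it is closed and $x\mapsto d(x,X)$ is an $A$-definable predicate. An *$A$-definable group* is an $A$-definable set $G$, contained in a sort $S$, with a group law $\cdot\colon G^2\to G$ which is an $A$-definable function, i.e. the function $(x,y,z)\mapsto d(x\cdot y,z)$ on $G^2\times S$ is the restriction of an $A$-definable predicate on $S^3$. **Proposition 3.13.** Let $\langle G,\cdot\rangle$ be an $A$-definable group, contained in the sort $S$. Then $G$ admits a total definable invariant metric: there is a metric $\rho$ on the whole sort $S$ which is an $A$-definable predicate and which is invariant on $G$, i.e. $\rho(gx,gy)=\rho(x,y)=\rho(xg,yg)$ for all $g,x,y\in G$. Moreover $\rho$ can be chosen so that $$\rho(x,y)=\sup_{u,v\in G} d(uxv,\,uyv)\qquad\text{for all }x,y\in G.$$ -/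

import Mathlib

universe u v w

namespace ContLogic

set_option linter.checkUnivs false in
/-- A (many-sorted) signature of continuous first-order logic. Every function and predicate symbol
carries a modulus of uniform continuity, taken with respect to the maximum metric on the product
of the sorts of its arguments. -/
structure Signature where
  Sorts : Type u
  Func : Type v
  funArity : Func → ℕ
  funDom : (f : Func) → Fin (funArity f) → Sorts
  funCod : Func → Sorts
  funMod : Func → ℝ → ℝ
  funMod_pos : ∀ f ε, 0 < ε → 0 < funMod f ε
  Rel : Type v
  relArity : Rel → ℕ
  relDom : (R : Rel) → Fin (relArity R) → Sorts
  relMod : Rel → ℝ → ℝ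
  relMod_pos : ∀ R ε, 0 < ε → 0 < relMod R ε

/-- A metric structure: each sort is a complete metric space of diameter at most `1`, and the
symbols are interpreted by functions and `[0,1]`-valued predicates that respect the prescribed
moduli of uniform continuity. -/
structure MetricStructure (L : Signature.{u, v}) where
  carrier : L.Sorts → Type w
  metric : ∀ s, MetricSpace (carrier s)
  complete : ∀ s, CompleteSpace (carrier s)
  dist_le_one : ∀ s (x y : carrier s), dist x y ≤ 1
  funMap : (f : L.Func) → (∀ i, carrier (L.funDom f i)) → carrier (L.funCod f)
  funMap_modulus : ∀ f ε, 0 < ε → ∀ x y, dist x y < L.funMod f ε →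
    dist (funMap f x) (funMap f y) ≤ ε
  relMap : (R : L.Rel) → (∀ i, carrier (L.relDom R i)) → unitInterval
  relMap_modulus : ∀ R ε, 0 < ε → ∀ x y, dist x y < L.relMod R ε →
    dist (relMap R x) (relMap R y) ≤ ε

attribute [instance] MetricStructure.metric MetricStructure.complete

/-- The product sort `∏ i, M_{σ i}`. For a finite index type it carries the maximum metric. -/
abbrev MetricStructure.Tuple {L : Signature.{u, v}} (M : MetricStructure.{u, v, w} L)
    {α : Type} (σ : α → L.Sorts) : Type w :=
  ∀ i, M.carrier (σ i)

/-- Add one variable of sort `s`, named `none`, to the variable context `σ`. -/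
def extend {S : Type u} {α : Type} (σ : α → S) (s : S) : Option α → S
  | none => s
  | some a => σ a

/-- Terms in the variables `i : α` (of sort `σ i`), with constants for the elements of `K`. -/
inductive Term (L : Signature.{u, v}) (K : L.Sorts → Type w) {α : Type} (σ : α → L.Sorts) :
    L.Sorts → Type (max u v w)
  | var (i : α) : Term L K σ (σ i)
  | param {s : L.Sorts} (c : K s) : Term L K σ s
  | app (f : L.Func) (t : ∀ i, Term L K σ (L.funDom f i)) : Term L K σ (L.funCod f)

/-- Formulae of continuous logic with free variables `i : α` (of sort `σ i`): atomic formulae,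
all continuous functions `[0,1]^k → [0,1]` as connectives, and the quantifiers `sup` and `inf`. -/
inductive Formula (L : Signature.{u, v}) (K : L.Sorts → Type w) :
    {α : Type} → (α → L.Sorts) → Type (max 1 u v w)
  | rel {α : Type} {σ : α → L.Sorts} (R : L.Rel) (t : ∀ i, Term L K σ (L.relDom R i)) :
      Formula L K σ
  | dist {α : Type} {σ : α → L.Sorts} {s : L.Sorts} (t₁ t₂ : Term L K σ s) : Formula L K σ
  | conn {α : Type} {σ : α → L.Sorts} {k : ℕ} (c : C(Fin k → unitInterval, unitInterval)) (φ : Fin k → Formula L K σ) :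
      Formula L K σ
  | sup {α : Type} {σ : α → L.Sorts} (s : L.Sorts) (φ : Formula L K (extend σ s)) : Formula L K σ
  | inf {α : Type} {σ : α → L.Sorts} (s : L.Sorts) (φ : Formula L K (extend σ s)) : Formula L K σ

section Semantics

variable {L : Signature.{u, v}} (M : MetricStructure.{u, v, w} L)

/-- Extend an assignment by the value `a` of the new variable. -/
def extendTuple {α : Type} {σ : α → L.Sorts} {s : L.Sorts} (a : M.carrier s) (x : M.Tuple σ) :
    M.Tuple (extend σ s)
  | none => a
  | some i => x i

/-- The pair `(x, y)` as a single tuple. -/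
def pair {α β : Type} {σ : α → L.Sorts} {τ : β → L.Sorts} (x : M.Tuple σ) (y : M.Tuple τ) :
    M.Tuple (Sum.elim σ τ)
  | Sum.inl i => x i
  | Sum.inr j => y j

variable {M} in
/-- The value of a term whose constants name elements of the parameter set `A`. -/
def Term.val {A : ∀ s, Set (M.carrier s)} {α : Type} {σ : α → L.Sorts} (x : M.Tuple σ) :
    {s : L.Sorts} → Term L (fun s => A s) σ s → M.carrier s
  | _, .var i => x i
  | _, .param c => c.1
  | _, .app f t => M.funMap f (fun i => (t i).val x)

variable {M} in
/-- The truth value of a formula. Suprema and infima are taken in the complete lattice `[0,1]`. -/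
noncomputable def Formula.val {A : ∀ s, Set (M.carrier s)} :
    {α : Type} → {σ : α → L.Sorts} → Formula L (fun s => A s) σ → M.Tuple σ → unitInterval
  | _, _, .rel R t, x => M.relMap R (fun i => (t i).val x)
  | _, _, .dist t₁ t₂, x =>
      ⟨Dist.dist (t₁.val x) (t₂.val x), dist_nonneg, M.dist_le_one _ _ _⟩
  | _, _, .conn c φ, x => c (fun i => (φ i).val x)
  | _, _, .sup s φ, x => ⨆ a : M.carrier s, φ.val (extendTuple M a x)
  | _, _, .inf s φ, x => ⨅ a : M.carrier s, φ.val (extendTuple M a x)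

/-- `P` is an `A`-definable predicate: a uniform limit of formulae with parameters in `A`
(so, automatically, `P` takes its values in `[0,1]`). -/
def IsDefinablePred (A : ∀ s, Set (M.carrier s)) {α : Type} {σ : α → L.Sorts}
    (P : M.Tuple σ → ℝ) : Prop :=
  ∀ ε : ℝ, 0 < ε → ∃ φ : Formula L (fun s => A s) σ, ∀ x, |P x - (φ.val x : ℝ)| ≤ ε

variable {ι : Type} [Fintype ι] {σ : ι → L.Sorts}

/-- `X` is an `A`-definable set: it is closed and `d(x, X)` is an `A`-definable predicate.
(For `X = ∅` Mathlib's `infDist` is constantly `0` rather than `1`; both constants are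
definable, so the empty set is definable under either convention.) -/
structure IsDefinableSet (A : ∀ s, Set (M.carrier s)) (X : Set (M.Tuple σ)) : Prop where
  isClosed : IsClosed X
  dist_definable : IsDefinablePred M A (fun x : M.Tuple σ => Metric.infDist x X)

/-- `f : X × X → X` is an `A`-definable function: the predicate `d(f(x, y), z)`, for `x, y ∈ X` and
`z` ranging over the whole sort of `X`, is the restriction of an `A`-definable predicate. -/
def IsDefinableOp (A : ∀ s, Set (M.carrier s)) (X : Set (M.Tuple σ)) (f : X → X → X) : Prop :=
  ∃ P : M.Tuple (Sum.elim (Sum.elim σ σ) σ) → ℝ, IsDefinablePred M A P ∧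
    ∀ (x y : X) (z : M.Tuple σ), P (pair M (pair M x.1 y.1) z) = dist (f x y).1 z

/-- The set `G` with the given group law is an `A`-definable group: the set is `A`-definable and
its multiplication is an `A`-definable function. -/
structure IsDefinableGroup (A : ∀ s, Set (M.carrier s)) (G : Set (M.Tuple σ)) [Group G] :
    Prop where
  isDefinableSet : IsDefinableSet M A G
  mul_definable : IsDefinableOp M A G (fun x y => x * y)

/-- The real-valued function `ρ` is a metric on `X` (nonnegativity follows from these axioms). -/
structure IsMetric {X : Type w} (ρ : X → X → ℝ) : Prop where
  eq_zero_iff : ∀ x y, ρ x y = 0 ↔ x = y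
  symm : ∀ x y, ρ x y = ρ y x
  triangle : ∀ x y z, ρ x z ≤ ρ x y + ρ y z

/-- `ρ` is a total `A`-definable metric on the sort `∏ i, M_{σ i}`. -/
structure IsTotalDefinableMetric (A : ∀ s, Set (M.carrier s))
    (ρ : M.Tuple σ → M.Tuple σ → ℝ) : Prop where
  isMetric : IsMetric ρ
  definable : IsDefinablePred M A
    (fun p : M.Tuple (Sum.elim σ σ) => ρ (fun i => p (Sum.inl i)) (fun i => p (Sum.inr i)))

/-- `ρ` is invariant on `G` under left and right translations by elements of `G`. -/
def IsInvariantOn (G : Set (M.Tuple σ)) [Group G] (ρ : M.Tuple σ → M.Tuple σ → ℝ) : Prop :=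
  ∀ g x y : G, ρ (g * x : G) (g * y : G) = ρ x y ∧ ρ (x * g : G) (y * g : G) = ρ x y

end Semantics

end ContLogic

namespace ContLogic

open Set

variable {L : Signature.{u, v}} {M : MetricStructure.{u, v, w} L} {A : ∀ s, Set (M.carrier s)}

/-! On `G` itself, the supremum of `d(uxv, uyv)` over `u, v ∈ G` is a metric, and it is invariant
because a translation only reparametrizes `u` or `v`. Two difficulties remain: this function must be
definable, and it must extend to a metric on the whole sort.

Definability rests on closure properties of definable predicates, above all
`IsDefinablePred.iSup_set`: a uniformly continuous predicate may be quantified over a definable set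
by penalizing distance from it. A similar penalty makes the intermediate product `t = ux` bound in
`d(tv, w)`. This approximates `d(uxv, w)` uniformly on `G`, and `IsDefinablePred.exists_extension`
turns approximations on `G` into a definable predicate `W` that is exact there. Since `d(a, b) =
sup_w |d(a, w) - d(b, w)|`, with the supremum attained at `w = b`, quantifying `W` over `G` yields a
definable `R` that agrees with the desired metric on `G`.

Off `G`, `R` need not be a metric. The Kuratowski-type formula `e(x, y) = sup_{z ∈ G} |R(x, z) -
R(y, z)|` is a pseudometric on the whole sort for any bounded `R`, and it returns `R` on `G`. Taking
the maximum with `d` separates points and changes nothing on `G`, where `d ≤ R`. -/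

/-! ### Substitution of terms and quantification over product sorts -/

/-- A map between product sorts all of whose coordinates are given by terms. -/
def IsTermMap (M : MetricStructure.{u, v, w} L) (A : ∀ s, Set (M.carrier s)) {α β : Type}
    {σ : α → L.Sorts} {τ : β → L.Sorts} (F : M.Tuple τ → M.Tuple σ) : Prop :=
  ∀ i, ∃ t : Term L (fun s => A s) τ (σ i), ∀ x, t.val x = F x i

theorem Term.exists_subst {α β : Type} {σ : α → L.Sorts} {τ : β → L.Sorts}
    {F : M.Tuple τ → M.Tuple σ} (hF : IsTermMap M A F) {s : L.Sorts}
    (t : Term L (fun s => A s) σ s) :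
    ∃ t' : Term L (fun s => A s) τ s, ∀ x, t'.val x = t.val (F x) := by
  induction t with
  | var i => exact hF i
  | param c => exact ⟨.param c, fun _ => rfl⟩
  | app f t ih =>
    choose t' ht' using ih
    exact ⟨.app f t', fun x => by simp only [Term.val, ht']⟩

theorem IsTermMap.extend {α β : Type} {σ : α → L.Sorts} {τ : β → L.Sorts}
    {F : M.Tuple τ → M.Tuple σ} (hF : IsTermMap M A F) (s : L.Sorts) :
    IsTermMap M A (σ := extend σ s) (τ := extend τ s)
      (fun y => extendTuple M (s := s) (y none) (F fun i => y (some i))) := by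
  rintro (_ | i)
  · exact ⟨.var (σ := ContLogic.extend τ s) none, fun _ => rfl⟩
  · obtain ⟨t, ht⟩ := hF i
    obtain ⟨t', ht'⟩ := Term.exists_subst (M := M) (A := A) (τ := ContLogic.extend τ s)
      (F := fun y i => y (some i))
      (fun i => ⟨.var (σ := ContLogic.extend τ s) (some i), fun _ => rfl⟩) t
    exact ⟨t', fun x => (ht' x).trans (ht _)⟩

/-- The target context and `F` are quantified inside the induction because a quantifier enlarges
both contexts; `IsTermMap.extend` carries `F` across it. -/
theorem Formula.exists_subst {α : Type} {σ : α → L.Sorts} (φ : Formula L (fun s => A s) σ) :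
    ∀ {β : Type} {τ : β → L.Sorts} {F : M.Tuple τ → M.Tuple σ}, IsTermMap M A F →
      ∃ ψ : Formula L (fun s => A s) τ, ∀ x, ψ.val x = φ.val (F x) := by
  induction φ with
  | rel R t =>
    intro β τ F hF
    choose t' ht' using fun i => Term.exists_subst hF (t i)
    exact ⟨.rel R t', fun x => by simp only [Formula.val, ht']⟩
  | dist t₁ t₂ =>
    intro β τ F hF
    obtain ⟨t₁', h₁⟩ := Term.exists_subst hF t₁
    obtain ⟨t₂', h₂⟩ := Term.exists_subst hF t₂
    exact ⟨.dist t₁' t₂', fun x => by simp only [Formula.val, h₁, h₂]⟩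
  | conn c φ ih =>
    intro β τ F hF
    choose ψ hψ using fun i => ih i hF
    exact ⟨.conn c ψ, fun x => by simp only [Formula.val, hψ]⟩
  | sup s φ ih =>
    intro β τ F hF
    obtain ⟨ψ, hψ⟩ := ih (hF.extend s)
    exact ⟨.sup s ψ, fun x => by simp only [Formula.val, hψ]; rfl⟩
  | inf s φ ih =>
    intro β τ F hF
    obtain ⟨ψ, hψ⟩ := ih (hF.extend s)
    exact ⟨.inf s ψ, fun x => by simp only [Formula.val, hψ]; rfl⟩

theorem IsTermMap.pair {α β γ : Type} {σ : α → L.Sorts} {τ : β → L.Sorts} {υ : γ → L.Sorts}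
    {F : M.Tuple υ → M.Tuple σ} {F' : M.Tuple υ → M.Tuple τ}
    (hF : IsTermMap M A F) (hF' : IsTermMap M A F') :
    IsTermMap M A (fun x => pair M (F x) (F' x)) := by
  rintro (i | i)
  · exact hF i
  · exact hF' i

/-- Quantification over a finite product of sorts. -/
theorem Formula.exists_iSup {ι : Type} [Finite ι] : ∀ {α : Type} {τ : α → L.Sorts}
    (σ : ι → L.Sorts) (φ : Formula L (fun s => A s) (Sum.elim τ σ)),
    ∃ ψ : Formula L (fun s => A s) τ, ∀ x : M.Tuple τ,
      ψ.val x = ⨆ y : M.Tuple σ, φ.val (ContLogic.pair M x y) := by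
  induction ι using Finite.induction_empty_option with
  | @of_equiv ι κ e ih =>
    intro α τ σ φ
    obtain ⟨φ', hφ'⟩ := φ.exists_subst (τ := Sum.elim τ (σ ∘ e))
      (F := fun x => ContLogic.pair M (fun i => x (Sum.inl i))
        ((e.piCongrLeft fun k => M.carrier (σ k)) fun j => x (Sum.inr j))) (by
        refine IsTermMap.pair (fun i => ⟨.var (σ := Sum.elim τ (σ ∘ e)) (Sum.inl i), fun _ => rfl⟩)
          fun k => ?_
        obtain ⟨j, rfl⟩ := e.surjective k
        exact ⟨.var (σ := Sum.elim τ (σ ∘ e)) (Sum.inr j), fun x =>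
          (Equiv.piCongrLeft_apply_apply (fun k => M.carrier (σ k)) e
            (fun j => x (Sum.inr j)) j).symm⟩)
    obtain ⟨ψ, hψ⟩ := ih (σ ∘ e) φ'
    refine ⟨ψ, fun x => ?_⟩
    rw [hψ]
    simp only [hφ']
    exact (e.piCongrLeft fun k => M.carrier (σ k)).iSup_comp
      (g := fun y => φ.val (ContLogic.pair M x y))
  | h_empty =>
    intro α τ σ φ
    obtain ⟨ψ, hψ⟩ := φ.exists_subst (F := fun x : M.Tuple τ =>
      ContLogic.pair M x (fun i : PEmpty => i.elim))
      (IsTermMap.pair (fun i => ⟨.var i, fun _ => rfl⟩) (fun i => i.elim))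
    refine ⟨ψ, fun x => ?_⟩
    rw [hψ, iSup_unique]
    congr 2
    exact Subsingleton.elim _ _
  | @h_option κ _ ih =>
    intro α τ σ φ
    -- The coordinate `none` of the quantified tuple becomes the variable bound by one `sup`; the
    -- other coordinates are left to the induction hypothesis.
    let C := ContLogic.extend (Sum.elim τ fun k => σ (some k)) (σ none)
    obtain ⟨φ', hφ'⟩ := φ.exists_subst
      (τ := C)
      (F := fun x => ContLogic.pair M (fun i => x (some (Sum.inl i)))
        (fun | none => x none | some k => x (some (Sum.inr k)))) (by
        refine IsTermMap.pair (fun i => ⟨.var (σ := C) (some (Sum.inl i)), fun _ => rfl⟩) ?_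
        rintro (_ | k)
        · exact ⟨.var (σ := C) none, fun _ => rfl⟩
        · exact ⟨.var (σ := C) (some (Sum.inr k)), fun _ => rfl⟩)
    obtain ⟨ψ, hψ⟩ := ih (fun k => σ (some k)) (.sup (σ none) φ')
    refine ⟨ψ, fun x => ?_⟩
    rw [hψ]
    simp only [Formula.val, hφ']
    apply le_antisymm
    · exact iSup_le fun y => iSup_le fun a => le_iSup (fun y => φ.val (ContLogic.pair M x y)) _
    · refine iSup_le fun y => ?_
      refine le_iSup_of_le (fun k => y (some k)) (le_iSup_of_le (y none) (le_of_eq ?_))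
      congr 2
      funext k
      cases k <;> rfl

/-! ### Uniform continuity of terms and formulae -/

/-- Uniform continuity with respect to the supremum of the coordinate distances; unlike
`UniformContinuous`, this makes sense for an infinite variable context. -/
def UnifCont {α : Type} {σ : α → L.Sorts} {Y : Type*} [Dist Y] (F : M.Tuple σ → Y) : Prop :=
  ∀ ε : ℝ, 0 < ε → ∃ δ : ℝ, 0 < δ ∧ ∀ x y, (∀ i, dist (x i) (y i) ≤ δ) → dist (F x) (F y) ≤ ε

theorem UnifCont.pi {α : Type} {σ : α → L.Sorts} {κ : Type*} [Fintype κ] {Y : κ → Type*}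
    [∀ k, PseudoMetricSpace (Y k)] {F : ∀ k, M.Tuple σ → Y k} (hF : ∀ k, UnifCont (F k)) :
    UnifCont fun x k => F k x := by
  intro ε hε
  choose δ hδ h using fun k => hF k ε hε
  obtain ⟨δ', hδ', h'⟩ : ∃ δ' > 0, ∀ k, δ' ≤ δ k := by
    rcases isEmpty_or_nonempty κ with hκ | hκ
    · exact ⟨1, one_pos, fun k => isEmptyElim k⟩
    · obtain ⟨k₀, hk₀⟩ := Finite.exists_min δ
      exact ⟨δ k₀, hδ k₀, hk₀⟩
  exact ⟨δ', hδ', fun x y hxy => (dist_pi_le_iff hε.le).2 fun k =>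
    h k x y fun i => (hxy i).trans (h' k)⟩

theorem UnifCont.comp_modulus {α : Type} {σ : α → L.Sorts} {Y Z : Type*} [Dist Y] [Dist Z]
    {F : M.Tuple σ → Y} (hF : UnifCont F) {g : Y → Z}
    (hg : ∀ ε : ℝ, 0 < ε → ∃ δ : ℝ, 0 < δ ∧ ∀ x y, dist x y < δ → dist (g x) (g y) ≤ ε) :
    UnifCont fun x => g (F x) := by
  intro ε hε
  obtain ⟨δ, hδ, h⟩ := hg ε hε
  -- Halving `δ` turns the non-strict bound of `UnifCont` into the strict one required by a modulus.
  obtain ⟨δ', hδ', h'⟩ := hF (δ / 2) (by positivity)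
  exact ⟨δ', hδ', fun x y hxy => h _ _ ((h' x y hxy).trans_lt (by linarith))⟩

theorem Term.unifCont {α : Type} {σ : α → L.Sorts} {s : L.Sorts}
    (t : Term L (fun s => A s) σ s) : UnifCont (M := M) (fun x => t.val x) := by
  induction t with
  | var i => exact fun ε hε => ⟨ε, hε, fun x y h => h i⟩
  | param c => exact fun ε hε => ⟨ε, hε, fun x y h => by simpa [Term.val] using hε.le⟩
  | app f t ih =>
    exact (UnifCont.pi ih).comp_modulus (g := M.funMap f)
      fun ε hε => ⟨_, L.funMod_pos f ε hε, M.funMap_modulus f ε hε⟩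

/-- Each side is bounded by the other shifted by `ε`. The shifted value may leave `[0,1]`, so it is
clamped with `projIcc` before the lattice property is applied. Working in the complete lattice also
covers an empty index type. -/
theorem dist_iSup_le_and_dist_iInf_le {κ : Type*} (f g : κ → unitInterval) {ε : ℝ} (hε : 0 < ε)
    (h : ∀ k, dist (f k) (g k) ≤ ε) :
    dist (⨆ k, f k) (⨆ k, g k) ≤ ε ∧ dist (⨅ k, f k) (⨅ k, g k) ≤ ε := by
  have hs : ∀ f g : κ → unitInterval, (∀ k, dist (f k) (g k) ≤ ε) →
      ((⨆ k, f k : unitInterval) : ℝ) ≤ (⨆ k, g k : unitInterval) + ε := by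
    intro f g h
    have : (⨆ k, f k) ≤ Set.projIcc (0 : ℝ) 1 zero_le_one ((⨆ k, g k : unitInterval) + ε) := by
      refine iSup_le fun k => Subtype.coe_le_coe.1 ?_
      rw [Set.coe_projIcc]
      have h1 : (g k : ℝ) ≤ (⨆ k, g k : unitInterval) := Subtype.coe_le_coe.2 (le_iSup g k)
      have h2 := abs_le.1 (h k)
      exact le_max_of_le_right (le_min (f k).2.2 (by linarith [h2.2]))
    have h3 := Subtype.coe_le_coe.2 this
    rw [Set.coe_projIcc] at h3
    refine h3.trans (max_le ?_ (min_le_right _ _))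
    have := (⨆ k, g k : unitInterval).2.1
    linarith
  have hi : ∀ f g : κ → unitInterval, (∀ k, dist (f k) (g k) ≤ ε) →
      ((⨅ k, f k : unitInterval) : ℝ) ≤ (⨅ k, g k : unitInterval) + ε := by
    intro f g h
    have : Set.projIcc (0 : ℝ) 1 zero_le_one ((⨅ k, f k : unitInterval) - ε) ≤ (⨅ k, g k) := by
      refine le_iInf fun k => Subtype.coe_le_coe.1 ?_
      rw [Set.coe_projIcc]
      have h1 : ((⨅ k, f k : unitInterval) : ℝ) ≤ f k := Subtype.coe_le_coe.2 (iInf_le f k)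
      have h2 := abs_le.1 (h k)
      exact max_le (g k).2.1 ((min_le_right _ _).trans (by linarith [h2.2]))
    have h3 := Subtype.coe_le_coe.2 this
    rw [Set.coe_projIcc, min_eq_right (by
      have := (⨅ k, f k : unitInterval).2.2
      linarith)] at h3
    linarith [le_max_right (0 : ℝ) ((⨅ k, f k : unitInterval) - ε)]
  have h' : ∀ k, dist (g k) (f k) ≤ ε := fun k => dist_comm (f k) (g k) ▸ h k
  exact ⟨abs_sub_le_iff.2 ⟨by linarith [hs f g h], by linarith [hs g f h']⟩,
    abs_sub_le_iff.2 ⟨by linarith [hi f g h], by linarith [hi g f h']⟩⟩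

theorem Formula.unifCont {α : Type} {σ : α → L.Sorts} (φ : Formula L (fun s => A s) σ) :
    UnifCont (M := M) (fun x => φ.val x) := by
  induction φ with
  | rel R t =>
    exact (UnifCont.pi fun i => (t i).unifCont).comp_modulus (g := M.relMap R)
      fun ε hε => ⟨_, L.relMod_pos R ε hε, M.relMap_modulus R ε hε⟩
  | dist t₁ t₂ =>
    intro ε hε
    obtain ⟨δ₁, hδ₁, h₁⟩ := t₁.unifCont (M := M) (ε / 2) (by positivity)
    obtain ⟨δ₂, hδ₂, h₂⟩ := t₂.unifCont (M := M) (ε / 2) (by positivity)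
    refine ⟨min δ₁ δ₂, lt_min hδ₁ hδ₂, fun x y h => ?_⟩
    refine (dist_dist_dist_le _ _ _ _).trans ?_
    linarith [h₁ x y fun i => (h i).trans (min_le_left _ _),
      h₂ x y fun i => (h i).trans (min_le_right _ _)]
  | conn c φ ih =>
    refine (UnifCont.pi ih).comp_modulus (g := c) fun ε hε => ?_
    obtain ⟨δ, hδ, h⟩ := Metric.uniformContinuous_iff.1
      (CompactSpace.uniformContinuous_of_continuous c.continuous) ε hε
    exact ⟨δ, hδ, fun x y hxy => (h hxy).le⟩
  | sup s φ ih =>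
    intro ε hε
    obtain ⟨δ, hδ, h⟩ := ih ε hε
    refine ⟨δ, hδ, fun x y hxy => (dist_iSup_le_and_dist_iInf_le _ _ hε fun a => h _ _ ?_).1⟩
    rintro (_ | i)
    · exact (dist_self a).trans_le hδ.le
    · exact hxy i
  | inf s φ ih =>
    intro ε hε
    obtain ⟨δ, hδ, h⟩ := ih ε hε
    refine ⟨δ, hδ, fun x y hxy => (dist_iSup_le_and_dist_iInf_le _ _ hε fun a => h _ _ ?_).2⟩
    rintro (_ | i)
    · exact (dist_self a).trans_le hδ.le
    · exact hxy i

/-! ### Closure properties of definable predicates -/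

namespace IsDefinablePred

variable {α β : Type} {σ : α → L.Sorts} {τ : β → L.Sorts} {P Q : M.Tuple σ → ℝ}

theorem of_approx (h : ∀ ε : ℝ, 0 < ε → ∃ P' : M.Tuple σ → ℝ, IsDefinablePred M A P' ∧
    ∀ x, |P x - P' x| ≤ ε) : IsDefinablePred M A P := by
  intro ε hε
  obtain ⟨P', hP', h'⟩ := h (ε / 2) (by positivity)
  obtain ⟨φ, hφ⟩ := hP' (ε / 2) (by positivity)
  exact ⟨φ, fun x => (abs_sub_le _ (P' x) _).trans (by linarith [h' x, hφ x])⟩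

theorem mem_Icc (hP : IsDefinablePred M A P) (x : M.Tuple σ) : P x ∈ Icc (0 : ℝ) 1 := by
  constructor
  · refine le_of_forall_pos_le_add fun ε hε => ?_
    obtain ⟨φ, hφ⟩ := hP ε hε
    linarith [(abs_le.1 (hφ x)).1, (φ.val x).2.1]
  · refine le_of_forall_pos_le_add fun ε hε => ?_
    obtain ⟨φ, hφ⟩ := hP ε hε
    linarith [(abs_le.1 (hφ x)).2, (φ.val x).2.2]

theorem comp_termMap (hP : IsDefinablePred M A P) {F : M.Tuple τ → M.Tuple σ}
    (hF : IsTermMap M A F) : IsDefinablePred M A (fun x => P (F x)) := by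
  intro ε hε
  obtain ⟨φ, hφ⟩ := hP ε hε
  obtain ⟨ψ, hψ⟩ := φ.exists_subst hF
  exact ⟨ψ, fun x => by rw [hψ]; exact hφ _⟩

/-- A continuous combination of definable predicates is definable. -/
theorem conn {κ : Type} [Fintype κ] {P : κ → M.Tuple σ → ℝ} (hP : ∀ k, IsDefinablePred M A (P k))
    {f : (κ → ℝ) → ℝ} (hf : Continuous f)
    (hf01 : ∀ y, (∀ k, y k ∈ Icc (0 : ℝ) 1) → f y ∈ Icc (0 : ℝ) 1) :
    IsDefinablePred M A (fun x => f fun k => P k x) := by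
  intro ε hε
  let g : (κ → unitInterval) → unitInterval := fun y => ⟨f fun k => y k, hf01 _ fun k => (y k).2⟩
  have hg : Continuous g := Continuous.subtype_mk (hf.comp (by fun_prop)) _
  obtain ⟨δ, hδ, h⟩ := Metric.uniformContinuous_iff.1
    (CompactSpace.uniformContinuous_of_continuous hg) ε hε
  choose φ hφ using fun k => hP k (δ / 2) (by positivity)
  let e := Fintype.equivFin κ
  refine ⟨.conn ⟨fun y => g fun k => y (e k), hg.comp (by fun_prop)⟩ fun i => φ (e.symm i),
    fun x => ?_⟩
  have := @h (fun k => ⟨P k x, (hP k).mem_Icc x⟩) (fun k => (φ k).val x) (by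
    refine lt_of_le_of_lt ((dist_pi_le_iff (by positivity)).2 fun k => hφ k x) ?_
    linarith)
  simp only [Formula.val, ContinuousMap.coe_mk, Equiv.symm_apply_apply]
  exact this.le

theorem conn₂ (hP : IsDefinablePred M A P) (hQ : IsDefinablePred M A Q) {f : ℝ → ℝ → ℝ}
    (hf : Continuous fun p : ℝ × ℝ => f p.1 p.2)
    (hf01 : ∀ a ∈ Icc (0 : ℝ) 1, ∀ b ∈ Icc (0 : ℝ) 1, f a b ∈ Icc (0 : ℝ) 1) :
    IsDefinablePred M A (fun x => f (P x) (Q x)) := by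
  refine conn (P := ![P, Q]) (f := fun y => f (y 0) (y 1)) (fun k => ?_) ?_
    (fun y hy => hf01 _ (hy 0) _ (hy 1))
  · fin_cases k
    · exact hP
    · exact hQ
  · exact hf.comp (f := fun y : Fin 2 → ℝ => (y 0, y 1)) (by fun_prop)

theorem abs_sub (hP : IsDefinablePred M A P) (hQ : IsDefinablePred M A Q) :
    IsDefinablePred M A (fun x => |P x - Q x|) :=
  hP.conn₂ hQ (f := fun a b => |a - b|) (by fun_prop) fun _ ha _ hb =>
    ⟨abs_nonneg _, abs_le.2 ⟨by linarith [ha.1, hb.2], by linarith [ha.2, hb.1]⟩⟩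

theorem max (hP : IsDefinablePred M A P) (hQ : IsDefinablePred M A Q) :
    IsDefinablePred M A (fun x => Max.max (P x) (Q x)) :=
  hP.conn₂ hQ (f := fun a b => Max.max a b) (by fun_prop) fun _ ha _ hb =>
    ⟨le_max_of_le_left ha.1, max_le ha.2 hb.2⟩

theorem one_sub (hP : IsDefinablePred M A P) : IsDefinablePred M A (fun x => 1 - P x) :=
  hP.conn₂ hP (f := fun a _ => 1 - a) (by fun_prop) fun _ ha _ _ =>
    ⟨by linarith [ha.2], by linarith [ha.1]⟩

protected theorem unifCont (hP : IsDefinablePred M A P) : UnifCont P := by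
  intro ε hε
  obtain ⟨φ, hφ⟩ := hP (ε / 3) (by positivity)
  obtain ⟨δ, hδ, h⟩ := φ.unifCont (M := M) (ε / 3) (by positivity)
  refine ⟨δ, hδ, fun x y hxy => ?_⟩
  have h1 := abs_le.1 (hφ x)
  have h2 := abs_le.1 (hφ y)
  have h3 : |((φ.val x : unitInterval) : ℝ) - (φ.val y : unitInterval)| ≤ ε / 3 := h x y hxy
  have h3 := abs_le.1 h3
  exact abs_le.2 ⟨by linarith, by linarith⟩

theorem bddAbove_range (hP : IsDefinablePred M A P) {κ : Type*} (f : κ → M.Tuple σ) :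
    BddAbove (range fun k => P (f k)) :=
  ⟨1, by rintro _ ⟨k, rfl⟩; exact (hP.mem_Icc _).2⟩

theorem iSup_pair {ι : Type} [Finite ι] {υ : ι → L.Sorts} [Nonempty (M.Tuple υ)]
    {P : M.Tuple (Sum.elim σ υ) → ℝ} (hP : IsDefinablePred M A P) :
    IsDefinablePred M A (fun x => ⨆ y : M.Tuple υ, P (pair M x y)) := by
  intro ε hε
  obtain ⟨φ, hφ⟩ := hP ε hε
  obtain ⟨ψ, hψ⟩ := Formula.exists_iSup υ φ
  refine ⟨ψ, fun x => ?_⟩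
  rw [hψ, Set.Icc.coe_iSup zero_le_one]
  have hbdd : BddAbove (range fun y : M.Tuple υ => (φ.val (pair M x y) : ℝ)) :=
    ⟨1, by rintro _ ⟨k, rfl⟩; exact (φ.val _).2.2⟩
  have h1 : ⨆ y : M.Tuple υ, P (pair M x y) ≤ (⨆ y, (φ.val (pair M x y) : ℝ)) + ε :=
    ciSup_le fun y => by
      linarith [(abs_le.1 (hφ (pair M x y))).2, le_ciSup hbdd y]
  have h2 : ⨆ y, (φ.val (pair M x y) : ℝ) ≤ (⨆ y : M.Tuple υ, P (pair M x y)) + ε :=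
    ciSup_le fun y => by
      linarith [(abs_le.1 (hφ (pair M x y))).1, le_ciSup (hP.bddAbove_range (pair M x)) y]
  exact abs_sub_le_iff.2 ⟨by linarith, by linarith⟩

/-- Definable predicates are closed under quantification over a nonempty definable set. -/
theorem iSup_set {ι : Type} [Fintype ι] {υ : ι → L.Sorts} {G : Set (M.Tuple υ)}
    (hG : IsDefinableSet M A G) (hne : G.Nonempty)
    {P : M.Tuple (Sum.elim σ υ) → ℝ} (hP : IsDefinablePred M A P) :
    IsDefinablePred M A (fun x => ⨆ y : G, P (pair M x y)) := by
  have : Nonempty G := hne.to_subtype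
  have : Nonempty (M.Tuple υ) := hne.to_type
  refine of_approx fun ε hε => ?_
  obtain ⟨δ, hδ, h⟩ := hP.unifCont ε hε
  have hd : IsDefinablePred M A (fun p : M.Tuple (Sum.elim σ υ) =>
      Metric.infDist (fun i => p (Sum.inr i)) G) :=
    hG.dist_definable.comp_termMap fun i => ⟨.var (σ := Sum.elim σ υ) (Sum.inr i), fun _ => rfl⟩
  -- The penalty `δ⁻¹ * d(y, G)` vanishes on `G` and is at least `1 ≥ P` beyond distance `δ`. Closer
  -- than `δ`, moving `y` to a point of `G` changes `P` by at most `ε`. Hence the supremum over the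
  -- whole sort is within `ε` of the supremum over `G`.
  have hQ : IsDefinablePred M A (fun p : M.Tuple (Sum.elim σ υ) =>
      Max.max 0 (P p - δ⁻¹ * Metric.infDist (fun i => p (Sum.inr i)) G)) :=
    hP.conn₂ hd (f := fun a b => Max.max 0 (a - δ⁻¹ * b)) (by fun_prop) fun a ha b hb =>
      ⟨le_max_left _ _, max_le zero_le_one (by
        have : 0 ≤ δ⁻¹ * b := mul_nonneg (inv_nonneg.2 hδ.le) hb.1
        linarith [ha.2])⟩
  refine ⟨_, hQ.iSup_pair, fun x => ?_⟩
  have hbdd := hP.bddAbove_range fun g : G => pair M x g.1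
  have h0 : 0 ≤ ⨆ y : G, P (pair M x y) :=
    (hP.mem_Icc _).1.trans (le_ciSup hbdd (Classical.arbitrary G))
  have h1 : (⨆ y : G, P (pair M x y)) ≤
      ⨆ y, Max.max 0 (P (pair M x y) - δ⁻¹ * Metric.infDist y G) := by
    refine ciSup_le fun g => (le_of_eq ?_).trans (le_ciSup (hQ.bddAbove_range (pair M x)) g.1)
    have : Metric.infDist (fun i => pair M x g.1 (Sum.inr i)) G = 0 :=
      Metric.infDist_zero_of_mem g.2
    rw [this, mul_zero, sub_zero, max_eq_right (hP.mem_Icc _).1]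
  have h2 : (⨆ y, Max.max 0 (P (pair M x y) - δ⁻¹ * Metric.infDist y G)) ≤
      (⨆ y : G, P (pair M x y)) + ε := by
    refine ciSup_le fun y => max_le (by linarith) ?_
    have hnn : 0 ≤ δ⁻¹ * Metric.infDist y G :=
      mul_nonneg (inv_nonneg.2 hδ.le) Metric.infDist_nonneg
    rcases lt_or_ge (Metric.infDist y G) δ with hy | hy
    · obtain ⟨g, hg, hyg⟩ := (Metric.infDist_lt_iff hne).1 hy
      have h3 : |P (pair M x y) - P (pair M x g)| ≤ ε := h _ _ (by
        rintro (i | i)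
        · exact (dist_self (x i)).trans_le hδ.le
        · exact (dist_le_pi_dist y g i).trans hyg.le)
      linarith [(abs_le.1 h3).2, le_ciSup hbdd ⟨g, hg⟩]
    · have : 1 ≤ δ⁻¹ * Metric.infDist y G := by
        rw [← inv_mul_cancel₀ hδ.ne']
        exact mul_le_mul_of_nonneg_left hy (inv_nonneg.2 hδ.le)
      linarith [(hP.mem_Icc (pair M x y)).2]
  have h3 : |(⨆ y : G, P (pair M x y)) -
      ⨆ y, Max.max 0 (P (pair M x y) - δ⁻¹ * Metric.infDist y G)| ≤ ε :=
    abs_sub_le_iff.2 ⟨by linarith, by linarith⟩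
  exact h3

/-- The maximum metric on a finite product of sorts is a definable predicate. -/
theorem dist {ι : Type} [Fintype ι] {υ : ι → L.Sorts} :
    IsDefinablePred M A (fun p : M.Tuple (Sum.elim υ υ) =>
      Dist.dist (α := M.Tuple υ) (fun i => p (Sum.inl i)) (fun i => p (Sum.inr i))) := by
  have h : ∀ i, IsDefinablePred M A (fun p : M.Tuple (Sum.elim υ υ) =>
      Dist.dist (α := M.carrier (υ i)) (p (Sum.inl i)) (p (Sum.inr i))) := fun i ε hε =>
    ⟨.dist (σ := Sum.elim υ υ) (s := υ i) (.var (σ := Sum.elim υ υ) (Sum.inl i))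
      (.var (σ := Sum.elim υ υ) (Sum.inr i)), fun x => by
        simp only [Formula.val]
        exact (by simpa using hε.le :
          |Dist.dist (α := M.carrier (υ i)) (x (Sum.inl i)) (x (Sum.inr i)) -
            Dist.dist (α := M.carrier (υ i)) (x (Sum.inl i)) (x (Sum.inr i))| ≤ ε)⟩
  convert conn h (f := fun y => ‖y‖) continuous_norm (fun y hy => ⟨norm_nonneg _,
    (pi_norm_le_iff_of_nonneg zero_le_one).2 fun i => by
      rw [Real.norm_of_nonneg (hy i).1]; exact (hy i).2⟩) using 2 with p
  apply le_antisymm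
  · refine (dist_pi_le_iff (norm_nonneg _)).2 fun i => (le_abs_self _).trans ?_
    exact norm_le_pi_norm (fun i : ι =>
      Dist.dist (α := M.carrier (υ i)) (p (Sum.inl i)) (p (Sum.inr i))) i
  · refine (pi_norm_le_iff_of_nonneg dist_nonneg).2 fun i => ?_
    refine (Real.norm_of_nonneg dist_nonneg).trans_le ?_
    exact dist_le_pi_dist (fun i => p (Sum.inl i)) (fun i => p (Sum.inr i)) i

/-- A function that is uniformly approximated by definable predicates on a family of points agrees
at these points with a definable predicate. -/
theorem exists_extension {κ : Type*} {F : κ → M.Tuple σ} {q : κ → ℝ}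
    (h : ∀ ε : ℝ, 0 < ε → ∃ P' : M.Tuple σ → ℝ,
      IsDefinablePred M A P' ∧ ∀ k, |P' (F k) - q k| ≤ ε) :
    ∃ P' : M.Tuple σ → ℝ, IsDefinablePred M A P' ∧ ∀ k, P' (F k) = q k := by
  choose φ hφ hφP using fun n : ℕ => h ((1 / 2) ^ n) (by positivity)
  -- Each new approximation is clamped to within `2 * (1/2)^n` of the previous term, which forces
  -- uniform convergence everywhere. At the points `F k`, consecutive approximations differ by at
  -- most `(1/2)^n + (1/2)^(n+1)`, so there the clamp has no effect.
  let ψ : ℕ → M.Tuple σ → ℝ := fun n => n.rec (φ 0) fun n ψ x =>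
    Max.max (ψ x - 2 * (1 / 2) ^ n) (min (ψ x + 2 * (1 / 2) ^ n) (φ (n + 1) x))
  have hψs : ∀ n x, ψ (n + 1) x =
    Max.max (ψ n x - 2 * (1 / 2) ^ n) (min (ψ n x + 2 * (1 / 2) ^ n) (φ (n + 1) x)) :=
    fun _ _ => rfl
  have hψ : ∀ n, IsDefinablePred M A (ψ n) := by
    intro n
    induction n with
    | zero => exact hφ 0
    | succ n ih =>
      refine ih.conn₂ (hφ (n + 1))
        (f := fun a b => Max.max (a - 2 * (1 / 2) ^ n) (min (a + 2 * (1 / 2) ^ n) b))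
        (by fun_prop) fun a ha b hb => ?_
      have : (0 : ℝ) ≤ 2 * (1 / 2) ^ n := by positivity
      exact ⟨le_max_of_le_right (le_min (by linarith [ha.1]) hb.1),
        max_le (by linarith [ha.2]) (min_le_of_right_le hb.2)⟩
  have hψX : ∀ n k, ψ n (F k) = φ n (F k) := by
    intro n k
    induction n with
    | zero => rfl
    | succ n ih =>
      have h1 := abs_le.1 (hφP n k)
      have h2 := abs_le.1 (hφP (n + 1) k)
      have h3 : (1 / 2 : ℝ) ^ (n + 1) ≤ (1 / 2) ^ n :=
        pow_le_pow_of_le_one (by norm_num) (by norm_num) (Nat.le_succ n)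
      rw [hψs, ih, min_eq_right (by linarith), max_eq_right (by linarith)]
  have hstep : ∀ x n, Dist.dist (ψ n x) (ψ (n + 1) x) ≤ 4 / 2 / 2 ^ n := by
    intro x n
    have hc : (4 / 2 / 2 ^ n : ℝ) = 2 * (1 / 2) ^ n := by
      rw [one_div, inv_pow]; ring
    have : (0 : ℝ) ≤ 2 * (1 / 2) ^ n := by positivity
    rw [hc, Real.dist_eq, hψs]
    have h1 := le_max_left (ψ n x - 2 * (1 / 2) ^ n)
      (min (ψ n x + 2 * (1 / 2) ^ n) (φ (n + 1) x))
    have h2 : Max.max (ψ n x - 2 * (1 / 2) ^ n) (min (ψ n x + 2 * (1 / 2) ^ n) (φ (n + 1) x)) ≤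
        ψ n x + 2 * (1 / 2) ^ n := max_le (by linarith) (min_le_left _ _)
    exact abs_sub_le_iff.2 ⟨by linarith, by linarith⟩
  choose P' hP' using fun x => cauchySeq_tendsto_of_complete
    (cauchySeq_of_le_geometric_two (hstep x))
  refine ⟨P', of_approx fun ε hε => ?_, fun k => ?_⟩
  · obtain ⟨n, hn⟩ := exists_pow_lt_of_lt_one (show 0 < ε / 4 by positivity)
      (show (1 / 2 : ℝ) < 1 by norm_num)
    refine ⟨ψ n, hψ n, fun x => ?_⟩
    have := dist_le_of_le_geometric_two_of_tendsto (hstep x) (hP' x) n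
    rw [abs_sub_comm]
    refine this.trans ?_
    have hc : (4 / 2 ^ n : ℝ) = 4 * (1 / 2) ^ n := by
      rw [one_div, inv_pow]; ring
    rw [hc]; linarith
  · refine tendsto_nhds_unique (hP' (F k)) ?_
    simp only [hψX _ k]
    refine tendsto_iff_dist_tendsto_zero.2 (squeeze_zero (fun _ => dist_nonneg)
      (fun n => hφP n k) ?_)
    exact tendsto_pow_atTop_nhds_zero_of_lt_one (by norm_num) (by norm_num)

end IsDefinablePred

/-! ### Definable predicates on a definable group -/

section Group

variable {ι : Type} [Fintype ι] {σ : ι → L.Sorts} {G : Set (M.Tuple σ)} [Group G]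

/-- The distance `d(u x v, w)` on a definable group is the restriction of a definable predicate. -/
theorem IsDefinableGroup.exists_dist_mul_mul (hG : IsDefinableGroup M A G) :
    ∃ W : M.Tuple (Sum.elim (Sum.elim (Sum.elim σ σ) σ) σ) → ℝ, IsDefinablePred M A W ∧
      ∀ u x v w : G, W (pair M (pair M (pair M u.1 x.1) v.1) w.1) =
        dist (u * x * v : G).1 w.1 := by
  obtain ⟨P, hP, hPG⟩ := hG.mul_definable
  have hne : G.Nonempty := ⟨_, (1 : G).2⟩
  let C := Sum.elim (Sum.elim (Sum.elim (Sum.elim σ σ) σ) σ) σ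
  -- `P(u, x, t)` and `P(t, v, w)` in the context `(u, x, v, w, t)`
  have h₁ : IsDefinablePred M A (fun p : M.Tuple C =>
      P (pair M (pair M (fun i => p (.inl (.inl (.inl (.inl i)))))
        (fun i => p (.inl (.inl (.inl (.inr i)))))) (fun i => p (.inr i)))) :=
    hP.comp_termMap (IsTermMap.pair (IsTermMap.pair
      (fun i => ⟨.var (σ := C) (.inl (.inl (.inl (.inl i)))), fun _ => rfl⟩)
      (fun i => ⟨.var (σ := C) (.inl (.inl (.inl (.inr i)))), fun _ => rfl⟩))
      (fun i => ⟨.var (σ := C) (.inr i), fun _ => rfl⟩))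
  have h₂ : IsDefinablePred M A (fun p : M.Tuple C =>
      P (pair M (pair M (fun i => p (.inr i))
        (fun i => p (.inl (.inl (.inr i))))) (fun i => p (.inl (.inr i))))) :=
    hP.comp_termMap (IsTermMap.pair (IsTermMap.pair
      (fun i => ⟨.var (σ := C) (.inr i), fun _ => rfl⟩)
      (fun i => ⟨.var (σ := C) (.inl (.inl (.inr i))), fun _ => rfl⟩))
      (fun i => ⟨.var (σ := C) (.inl (.inr i)), fun _ => rfl⟩))
  obtain ⟨W, hW, hWG⟩ := IsDefinablePred.exists_extension (M := M) (A := A)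
    (F := fun g : G × G × G × G => pair M (pair M (pair M g.1.1 g.2.1.1) g.2.2.1.1) g.2.2.2.1)
    (q := fun g => dist (g.1 * g.2.1 * g.2.2.1 : G).1 g.2.2.2.1) (by
      intro ε hε
      obtain ⟨δ, hδ, h⟩ := hP.unifCont ε hε
      -- The approximation is `inf_t min 1 (δ⁻¹ d(ux, t) + d(tv, w))`, written as one minus a
      -- supremum. The choice `t = ux` bounds it above by `d(uxv, w)`. For the lower bound, a `t`
      -- within `δ` of `ux` costs at most `ε` by uniform continuity of `P`, and a farther `t` pays a
      -- penalty of at least `1`.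
      have h₃ := h₁.conn₂ h₂ (f := fun a b => 1 - min 1 (δ⁻¹ * a + b)) (by fun_prop)
        fun a ha b hb => ⟨sub_nonneg.2 (min_le_left _ _), sub_le_self _
          (le_min zero_le_one (add_nonneg (mul_nonneg (inv_nonneg.2 hδ.le) ha.1) hb.1))⟩
      refine ⟨_, (h₃.iSup_set hG.isDefinableSet hne).one_sub, ?_⟩
      rintro ⟨u, x, v, w⟩
      let f : G → ℝ := fun t => 1 - min 1 (δ⁻¹ * dist (u * x : G).1 t.1 + dist (t * v : G).1 w.1)
      have hf : ∀ t : G, 1 - min 1 (δ⁻¹ * P (pair M (pair M u.1 x.1) t.1) +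
          P (pair M (pair M t.1 v.1) w.1)) = f t := fun t => by rw [hPG, hPG]
      have hbdd : BddAbove (range f) := ⟨1, by
        rintro _ ⟨t, rfl⟩
        exact sub_le_self _ (le_min zero_le_one (by positivity))⟩
      have hlow : 1 - dist (u * x * v : G).1 w.1 ≤ ⨆ t, f t := by
        refine le_trans ?_ (le_ciSup hbdd (u * x))
        simp only [f, dist_self, mul_zero, zero_add]
        exact sub_le_sub_left (min_le_right _ _) _
      have hup : ⨆ t, f t ≤ 1 - dist (u * x * v : G).1 w.1 + ε := by
        have h1 : dist (u * x * v : G).1 w.1 ≤ 1 := by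
          rw [← hPG]; exact (hP.mem_Icc _).2
        refine ciSup_le fun t => ?_
        suffices dist (u * x * v : G).1 w.1 - ε ≤
            min 1 (δ⁻¹ * dist (u * x : G).1 t.1 + dist (t * v : G).1 w.1) by
          simp only [f]; linarith
        refine le_min (by linarith) ?_
        rcases le_or_gt (dist (u * x : G).1 t.1) δ with ht | ht
        · have h2 : |P (pair M (pair M (u * x : G).1 v.1) w.1) -
              P (pair M (pair M t.1 v.1) w.1)| ≤ ε := h _ _ (by
            rintro ((i | i) | i)
            · exact (dist_le_pi_dist (u * x : G).1 t.1 i).trans ht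
            · exact (dist_self (v.1 i)).trans_le hδ.le
            · exact (dist_self (w.1 i)).trans_le hδ.le)
          rw [hPG, hPG] at h2
          have h3 : 0 ≤ δ⁻¹ * dist (u * x : G).1 t.1 := by positivity
          linarith [(abs_le.1 h2).2]
        · have h2 : 1 ≤ δ⁻¹ * dist (u * x : G).1 t.1 := by
            rw [← inv_mul_cancel₀ hδ.ne']
            exact mul_le_mul_of_nonneg_left ht.le (inv_nonneg.2 hδ.le)
          have h3 : 0 ≤ dist (t * v : G).1 w.1 := dist_nonneg
          linarith
      have key : |1 - (⨆ t, f t) - dist (u * x * v : G).1 w.1| ≤ ε :=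
        abs_sub_le_iff.2 ⟨by linarith, by linarith⟩
      rw [← iSup_congr hf] at key
      exact key)
  exact ⟨W, hW, fun u x v w => hWG (u, x, v, w)⟩

/-- The bi-invariant metric `sup_{u, v} d(u x v, u y v)` on a definable group is the restriction of
a definable predicate. -/
theorem IsDefinableGroup.exists_isLUB_dist (hG : IsDefinableGroup M A G) :
    ∃ R : M.Tuple (Sum.elim σ σ) → ℝ, IsDefinablePred M A R ∧
      ∀ x y : G, IsLUB (range fun p : G × G => dist (p.1 * x * p.2 : G).1 (p.1 * y * p.2 : G).1)
        (R (pair M x.1 y.1)) := by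
  obtain ⟨W, hW, hWG⟩ := hG.exists_dist_mul_mul
  have hne : G.Nonempty := ⟨_, (1 : G).2⟩
  let C := Sum.elim (Sum.elim (Sum.elim (Sum.elim σ σ) σ) σ) σ
  -- `W(u, x, v, w)` and `W(u, y, v, w)` in the context `(x, y, u, v, w)`
  have h₁ : IsDefinablePred M A (fun p : M.Tuple C =>
      W (pair M (pair M (pair M (fun i => p (.inl (.inl (.inr i))))
        (fun i => p (.inl (.inl (.inl (.inl i))))))
        (fun i => p (.inl (.inr i)))) (fun i => p (.inr i)))) :=
    hW.comp_termMap (IsTermMap.pair (IsTermMap.pair (IsTermMap.pair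
      (fun i => ⟨.var (σ := C) (.inl (.inl (.inr i))), fun _ => rfl⟩)
      (fun i => ⟨.var (σ := C) (.inl (.inl (.inl (.inl i)))), fun _ => rfl⟩))
      (fun i => ⟨.var (σ := C) (.inl (.inr i)), fun _ => rfl⟩))
      (fun i => ⟨.var (σ := C) (.inr i), fun _ => rfl⟩))
  have h₂ : IsDefinablePred M A (fun p : M.Tuple C =>
      W (pair M (pair M (pair M (fun i => p (.inl (.inl (.inr i))))
        (fun i => p (.inl (.inl (.inl (.inr i))))))
        (fun i => p (.inl (.inr i)))) (fun i => p (.inr i)))) :=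
    hW.comp_termMap (IsTermMap.pair (IsTermMap.pair (IsTermMap.pair
      (fun i => ⟨.var (σ := C) (.inl (.inl (.inr i))), fun _ => rfl⟩)
      (fun i => ⟨.var (σ := C) (.inl (.inl (.inl (.inr i)))), fun _ => rfl⟩))
      (fun i => ⟨.var (σ := C) (.inl (.inr i)), fun _ => rfl⟩))
      (fun i => ⟨.var (σ := C) (.inr i), fun _ => rfl⟩))
  have h₃ := h₁.abs_sub h₂
  have h₄ := h₃.iSup_set hG.isDefinableSet hne
  have h₅ := h₄.iSup_set hG.isDefinableSet hne
  refine ⟨_, h₅.iSup_set hG.isDefinableSet hne, fun x y => ?_⟩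
  have hle : ∀ u v w : G, |W (pair M (pair M (pair M u.1 x.1) v.1) w.1) -
      W (pair M (pair M (pair M u.1 y.1) v.1) w.1)| ≤
        dist (u * x * v : G).1 (u * y * v : G).1 := fun u v w => by
    rw [hWG, hWG]; exact abs_dist_sub_le _ _ _
  constructor
  · rintro _ ⟨⟨u, v⟩, rfl⟩
    -- At `w = uyv` the second distance is zero, so the difference is exactly `d(uxv, uyv)`.
    refine le_trans (le_of_eq ?_) ((le_ciSup (h₃.bddAbove_range fun w : G =>
      pair M (pair M (pair M (pair M x.1 y.1) u.1) v.1) w.1) (u * y * v)).trans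
      ((le_ciSup (h₄.bddAbove_range fun v : G =>
      pair M (pair M (pair M x.1 y.1) u.1) v.1) v).trans
      (le_ciSup (h₅.bddAbove_range fun u : G => pair M (pair M x.1 y.1) u.1) u)))
    have := hWG u x v (u * y * v)
    have h' := hWG u y v (u * y * v)
    rw [dist_self] at h'
    have h'' : |W (pair M (pair M (pair M u.1 x.1) v.1) (u * y * v : G).1) -
      W (pair M (pair M (pair M u.1 y.1) v.1) (u * y * v : G).1)| =
        dist (u * x * v : G).1 (u * y * v : G).1 := by
      rw [this, h', sub_zero, abs_of_nonneg dist_nonneg]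
    exact h''.symm
  · intro c hc
    exact ciSup_le fun u => ciSup_le fun v => ciSup_le fun w =>
      (hle u v w).trans (hc ⟨(u, v), rfl⟩)

end Group

end ContLogic

/-! ### Extending the invariant metric to the whole sort -/

open ContLogic in
theorem proposition3p13 {L : ContLogic.Signature.{u, v}} (M : ContLogic.MetricStructure.{u, v, w} L)
    (A : ∀ s, Set (M.carrier s)) {ι : Type} [Fintype ι] (σ : ι → L.Sorts)
    (G : Set (M.Tuple σ)) [Group G] (hG : ContLogic.IsDefinableGroup M A G) :
    ∃ ρ : M.Tuple σ → M.Tuple σ → ℝ,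
      ContLogic.IsTotalDefinableMetric M A ρ ∧
      ContLogic.IsInvariantOn M G ρ ∧
      ∀ x y : G, IsLUB
        (Set.range fun p : G × G =>
          dist ((p.1 * x * p.2 : G) : M.Tuple σ) ((p.1 * y * p.2 : G) : M.Tuple σ))
        (ρ x y) := by
  obtain ⟨R, hR, hRG⟩ := hG.exists_isLUB_dist
  have hne : G.Nonempty := ⟨_, (1 : G).2⟩
  let C := Sum.elim (Sum.elim σ σ) σ
  have h₁ : IsDefinablePred M A (fun p : M.Tuple C =>
      R (pair M (fun i => p (.inl (.inl i))) (fun i => p (.inr i)))) :=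
    hR.comp_termMap (IsTermMap.pair
      (fun i => ⟨.var (σ := C) (.inl (.inl i)), fun _ => rfl⟩)
      (fun i => ⟨.var (σ := C) (.inr i), fun _ => rfl⟩))
  have h₂ : IsDefinablePred M A (fun p : M.Tuple C =>
      R (pair M (fun i => p (.inl (.inr i))) (fun i => p (.inr i)))) :=
    hR.comp_termMap (IsTermMap.pair
      (fun i => ⟨.var (σ := C) (.inl (.inr i)), fun _ => rfl⟩)
      (fun i => ⟨.var (σ := C) (.inr i), fun _ => rfl⟩))
  have h₃ := h₁.abs_sub h₂
  have h₄ := h₃.iSup_set hG.isDefinableSet hne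
  -- Symmetry and the triangle inequality for `e` come from the absolute value, so nothing is needed
  -- of `R` off `G` except boundedness.
  let e : M.Tuple σ → M.Tuple σ → ℝ := fun x y =>
    ⨆ z : G, |R (pair M x z.1) - R (pair M y z.1)|
  have hle : ∀ x y (z : G), |R (pair M x z.1) - R (pair M y z.1)| ≤ e x y := fun x y z =>
    le_ciSup (h₃.bddAbove_range fun z : G => pair M (pair M x y) z.1) z
  let ρ : M.Tuple σ → M.Tuple σ → ℝ := fun x y => max (dist x y) (e x y)
  have hR0 : ∀ y : G, R (pair M y.1 y.1) = 0 := fun y =>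
    le_antisymm ((hRG y y).2 (by rintro _ ⟨p, rfl⟩; exact (dist_self _).le)) (hR.mem_Icc _).1
  have hsymm : ∀ x y : G, R (pair M x.1 y.1) ≤ R (pair M y.1 x.1) := fun x y =>
    (hRG x y).2 (by
      rintro _ ⟨p, rfl⟩
      exact (dist_comm _ _).trans_le ((hRG y x).1 ⟨p, rfl⟩))
  have htri : ∀ x y z : G, R (pair M x.1 z.1) ≤ R (pair M x.1 y.1) + R (pair M y.1 z.1) :=
    fun x y z => (hRG x z).2 (by
      rintro _ ⟨p, rfl⟩
      exact (dist_triangle _ (p.1 * y * p.2 : G).1 _).trans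
        (add_le_add ((hRG x y).1 ⟨p, rfl⟩) ((hRG y z).1 ⟨p, rfl⟩)))
  have hρ : ∀ x y : G, ρ x y = R (pair M x.1 y.1) := by
    intro x y
    apply le_antisymm
    -- The pair `(1, 1)` gives `d ≤ R` on `G`; the bound on `e` is the reverse triangle inequality
    -- for `R`.
    · refine max_le ((hRG x y).1 ⟨(1, 1), by simp⟩) (ciSup_le fun z => abs_sub_le_iff.2 ⟨?_, ?_⟩)
      · linarith [htri x y z]
      · linarith [htri y x z, hsymm y x]
    -- Testing `e` at `z = y`, where `R(y, y) = 0`, recovers `R(x, y)`.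
    · refine le_max_of_le_right (le_trans ?_ (hle x y y))
      rw [hR0, sub_zero]
      exact le_abs_self _
  have hinv : ∀ g x y : G, R (pair M (g * x : G).1 (g * y : G).1) ≤ R (pair M x.1 y.1) ∧
      R (pair M (x * g : G).1 (y * g : G).1) ≤ R (pair M x.1 y.1) := by
    -- A left factor `g` is absorbed into `u` and a right factor into `v`. Only inequalities are
    -- needed here: applying them to `g⁻¹` gives the converses.
    refine fun g x y => ⟨(hRG _ _).2 ?_, (hRG _ _).2 ?_⟩
    · rintro _ ⟨⟨a, b⟩, rfl⟩
      exact (hRG x y).1 ⟨(a * g, b), by simp only [mul_assoc]⟩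
    · rintro _ ⟨⟨a, b⟩, rfl⟩
      exact (hRG x y).1 ⟨(a, g * b), by simp only [mul_assoc]⟩
  refine ⟨ρ, ⟨⟨fun x y => ⟨fun h => ?_, ?_⟩, fun x y => ?_, fun x y z => ?_⟩, ?_⟩,
    fun g x y => ?_, fun x y => hρ x y ▸ hRG x y⟩
  · exact dist_le_zero.1 (h ▸ le_max_left _ _)
  · rintro rfl
    simp [ρ, e]
  · simp only [ρ, e, dist_comm x y, abs_sub_comm (R (pair M x _))]
  · refine max_le ((dist_triangle x y z).trans (add_le_add (le_max_left _ _) (le_max_left _ _)))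
      (ciSup_le fun t => (abs_sub_le _ (R (pair M y t.1)) _).trans
        (add_le_add (le_max_of_le_right (hle x y t)) (le_max_of_le_right (hle y z t))))
  · exact IsDefinablePred.dist.max h₄
  · rw [hρ, hρ, hρ]
    refine ⟨le_antisymm (hinv g x y).1 ?_, le_antisymm (hinv g x y).2 ?_⟩
    · simpa using (hinv g⁻¹ (g * x) (g * y)).1
    · simpa using (hinv g⁻¹ (x * g) (y * g)).2
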